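/- Let $d,k,n$ be integers with $d\le kn$, let $\{e_i\}_{i=1}^k$ be an orthonormal basis of $\mathbb C^k$, and let $V:\mathbb C^d\to\mathbb C^k\otimes\mathbb C^n$ be a Haar-distributed random isometry, i.e. its law is the probability measure on isometries that is invariant under $V\mapsto U_2VU_1$ for all unitaries $U_1\in\mathcal U(d)$, $U_2\in\mathcal U(kn)$. The Haar-random POVM $(M_1,\dots,M_k)$ is given by $$M_i=V^*\bigl(|e_i\rangle\langle e_i|\otimes I_n\bigr)V\in\mathcal M_d(\mathbb C).$$ For a permutation $\sigma$ let $\#\sigma$ be its number of cycles (fixed points included), let $\gamma=(p\;p-1\;\cdots\;2\;1)\in\mathcal S_p$, and let $\operatorname{Wg}(N,\cdot):\mathcal S_p\to\mathbb R$ be the unitary Weingarten function, the inverse of $\alpha\mapsto N^{\#\alpha}$ for convolution on $\mathcal S_p$; this is to be read as the Moore--Penrose pseudo-inverse when $p>N$, where no inverse exists. That is, $\operatorname{Wg}(N,\sigma^{-1}\tau)$ is the $(\sigma,\tau)$ entry of the pseudo-inverse of the matrix $\bigl(N^{\#(\sigma^{-1}\tau)}\bigr)_{\sigma,\tau\in\mathcal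 S_p}$. Then, for every $i$ and every integer $p\ge1$, $\operatorname{Tr}M_i^p$ is integrable and $$\mathbb E\operatorname{Tr}M_i^p=\sum_{\alpha,\beta\in\mathcal S_p}n^{\#\alpha}\,d^{\#(\beta\gamma^{-1})}\operatorname{Wg}(kn,\alpha^{-1}\beta).$$ In particular, for every $i$, $$\mathbb E\operatorname{Tr}M_i=dn\operatorname{Wg}(kn,(1))=\frac dk,$$ $$\mathbb E\operatorname{Tr}M_i^2=(n^2d+nd^2)\operatorname{Wg}(kn,\mathrm{id})+(n^2d^2+nd)\operatorname{Wg}(kn,(1\,2)),$$ and, if $kn\ne1$, $$\mathbb E\operatorname{Tr}M_i^2=\frac{d\,(kn^2+dn(k-1)-1)}{k((kn)^2-1)}.$$ Moreover, for all $i\ne j$, $\operatorname{Tr}(M_iM_j)$ is integrable and $$\mathbb E\operatorname{Tr}(M_iM_j)=n^2d\operatorname{Wg}(kn,\mathrm{id})+n^2d^2\operatorname{Wg}(kn,(1\,2))=\frac{nd(kn-d)}{k((kn)^2-1)}.$$ Here $d,k,n\ge 0$ are allowed (the statements are about the indices $i,j\in\{1,\dots,k\}$). -/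

import Mathlib

/-- The number `#σ` of cycles of a permutation, fixed points included
(the number of orbits of `σ`). -/
noncomputable def cycleCount {p : ℕ} (σ : Equiv.Perm (Fin p)) : ℕ :=
  Nat.card (Quotient (Equiv.Perm.SameCycle.setoid σ))

/-- The full cycle `γ = (p p-1 ⋯ 3 2 1)`, sending `l` to `l - 1` cyclically. -/
def fullCycle (p : ℕ) : Equiv.Perm (Fin p) := (finRotate p)⁻¹

/-- The matrix `(N ^ #(σ⁻¹τ))_{σ,τ ∈ S_p}` of convolution with the function `α ↦ N ^ #α`. -/
noncomputable def gramMatrix (p N : ℕ) :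
    Matrix (Equiv.Perm (Fin p)) (Equiv.Perm (Fin p)) ℝ :=
  Matrix.of fun σ τ => (N : ℝ) ^ cycleCount (σ⁻¹ * τ)

/-- The unitary Weingarten function: the inverse of `α ↦ N ^ #α` for convolution on `S_p`,
in the sense of the Moore-Penrose pseudo-inverse, so that it is defined for all `p` and `N`.
The pseudo-inverse of the symmetric matrix `gramMatrix p N` is obtained by applying
`x ↦ x⁻¹` (with `0⁻¹ = 0`) to its eigenvalues. See `gramMatrix_penrose`,
`pinv_gramMatrix_apply` and, for `p ≤ N`, `weingarten_convolution`. -/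
noncomputable def weingarten {p : ℕ} (N : ℕ) (α : Equiv.Perm (Fin p)) : ℝ :=
  (cfc (fun x : ℝ => x⁻¹) (gramMatrix p N)) 1 α

theorem cycleCount_inv {p : ℕ} (σ : Equiv.Perm (Fin p)) : cycleCount σ⁻¹ = cycleCount σ := by
  unfold cycleCount
  have : Equiv.Perm.SameCycle.setoid σ⁻¹ = Equiv.Perm.SameCycle.setoid σ := by
    ext x y
    exact Equiv.Perm.sameCycle_inv
  rw [this]

theorem gramMatrix_isSelfAdjoint (p N : ℕ) : IsSelfAdjoint (gramMatrix p N) := by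
  rw [isSelfAdjoint_iff, Matrix.star_eq_conjTranspose]
  ext σ τ
  simp only [gramMatrix, Matrix.conjTranspose_apply, Matrix.of_apply, star_trivial]
  rw [← cycleCount_inv, mul_inv_rev, inv_inv]

/-- The Penrose equations characterising the pseudo-inverse of `gramMatrix p N`. -/
theorem gramMatrix_penrose (p N : ℕ) :
    let G := gramMatrix p N
    let W := cfc (fun x : ℝ => x⁻¹) G
    G * W * G = G ∧ W * G * W = W ∧ IsSelfAdjoint W ∧ G * W = W * G := by
  intro G W
  have hG : IsSelfAdjoint G := gramMatrix_isSelfAdjoint p N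
  have hfin : (spectrum ℝ G).Finite := Matrix.finite_real_spectrum
  have hc : ∀ f : ℝ → ℝ, ContinuousOn f (spectrum ℝ G) := fun f => hfin.continuousOn f
  have hid : G = cfc (fun x : ℝ => x) G := (cfc_id' ℝ G).symm
  have hGW : G * W = cfc (fun x : ℝ => x * x⁻¹) G := by
    rw [cfc_mul _ _ G (hc _) (hc _), ← hid]
  have hWG : W * G = cfc (fun x : ℝ => x * x⁻¹) G := by
    have : (fun x : ℝ => x * x⁻¹) = fun x : ℝ => x⁻¹ * x := by
      ext x
      exact mul_comm _ _
    rw [this, cfc_mul _ _ G (hc _) (hc _), ← hid]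
  refine ⟨?_, ?_, cfc_predicate _ _, hGW.trans hWG.symm⟩
  · have h1 : G * W * G = cfc (fun x : ℝ => x * x⁻¹ * x) G := by
      rw [cfc_mul _ _ G (hc _) (hc _), ← hid, hGW]
    have h2 : (fun x : ℝ => x * x⁻¹ * x) = fun x : ℝ => x := by
      ext x
      exact mul_inv_mul_cancel x
    rw [h1, h2, ← hid]
  · have h1 : W * G * W = cfc (fun x : ℝ => x * x⁻¹ * x⁻¹) G := by
      rw [cfc_mul _ _ G (hc _) (hc _), hWG]
    have h2 : (fun x : ℝ => x * x⁻¹ * x⁻¹) = fun x : ℝ => x⁻¹ := by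
      ext x
      by_cases hx : x = 0 <;> simp [hx]
    rw [h1, h2]

/-- The pseudo-inverse of `gramMatrix p N` is convolution with the Weingarten function. -/
theorem pinv_gramMatrix_apply (p N : ℕ) (σ τ : Equiv.Perm (Fin p)) :
    (cfc (fun x : ℝ => x⁻¹) (gramMatrix p N)) σ τ = weingarten N (σ⁻¹ * τ) := by
  obtain ⟨h1, h2, -, h4⟩ := gramMatrix_penrose p N
  set G := gramMatrix p N with hG
  set W := cfc (fun x : ℝ => x⁻¹) G with hW
  let e : Equiv.Perm (Fin p) ≃ Equiv.Perm (Fin p) := Equiv.mulLeft σ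
  let W' := W.submatrix e e
  have hGe : G.submatrix e e = G := by
    ext a b
    simp only [hG, gramMatrix, e, Matrix.submatrix_apply, Matrix.of_apply, Equiv.coe_mulLeft]
    congr 2
    group
  have k1 : G * W' * G = G := by
    have := congrArg (fun M => Matrix.submatrix M e e) h1
    simpa only [← Matrix.submatrix_mul_equiv _ _ e e e, hGe] using this
  have k2 : W' * G * W' = W' := by
    have := congrArg (fun M => Matrix.submatrix M e e) h2
    simpa only [← Matrix.submatrix_mul_equiv _ _ e e e, hGe] using this
  have k4 : G * W' = W' * G := by
    have := congrArg (fun M => Matrix.submatrix M e e) h4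
    simpa only [← Matrix.submatrix_mul_equiv _ _ e e e, hGe] using this
  have a1 : W * G = W' * G := by
    calc W * G = W * (G * W' * G) := by rw [k1]
      _ = (W * G) * (W' * G) := by simp only [mul_assoc]
      _ = (G * W) * (G * W') := by rw [h4, k4]
      _ = (G * W * G) * W' := by simp only [mul_assoc]
      _ = W' * G := by rw [h1, k4]
  have a2 : W = W' := by
    calc W = W * (G * W) := by rw [← mul_assoc, h2]
      _ = W * (G * W') := by rw [h4, a1, k4]
      _ = W' * G * W' := by rw [← mul_assoc, a1]
      _ = W' := k2
  have := congrFun (congrFun a2 1) (σ⁻¹ * τ)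
  simp only [W', e, Matrix.submatrix_apply, Equiv.coe_mulLeft, mul_one,
    mul_inv_cancel_left] at this
  exact this.symm

/-- `N ^ #σ` counts the `σ`-invariant functions to an `N`-element set. -/
theorem card_invariant_eq (p N : ℕ) (σ : Equiv.Perm (Fin p)) :
    Fintype.card {f : Fin p → Fin N // f ∘ σ = f} = N ^ cycleCount σ := by
  have hpow : ∀ f : Fin p → Fin N, f ∘ σ = f → ∀ (z : ℤ) (x : Fin p), f ((σ ^ z) x) = f x := by
    intro f hf z
    have hf1 : ∀ x, f (σ x) = f x := fun x => congrFun hf x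
    induction z using Int.induction_on with
    | zero => simp
    | succ i ih =>
      intro x
      rw [zpow_add_one, Equiv.Perm.mul_apply, ih, hf1]
    | pred i ih =>
      intro x
      rw [zpow_sub_one, Equiv.Perm.mul_apply, ih]
      conv_rhs => rw [← Equiv.apply_symm_apply σ x]
      rw [hf1]
      rfl
  let E : {f : Fin p → Fin N // f ∘ σ = f} ≃
      (Quotient (Equiv.Perm.SameCycle.setoid σ) → Fin N) :=
    { toFun := fun f => Quotient.lift f.1 (by
        rintro a b ⟨z, hz⟩
        rw [← hz, hpow f.1 f.2])
      invFun := fun g => ⟨fun x => g (Quotient.mk _ x), by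
        ext x
        have : (Quotient.mk (Equiv.Perm.SameCycle.setoid σ) (σ x)) = Quotient.mk _ x :=
          Quotient.sound ⟨-1, by simp⟩
        simp [this]⟩
      left_inv := fun f => rfl
      right_inv := fun g => by
        funext q
        induction q using Quotient.inductionOn
        rfl }
  rw [← Nat.card_eq_fintype_card, Nat.card_congr E, Nat.card_fun, Nat.card_fin, cycleCount]

/-- For `p ≤ N` the Weingarten function is the convolution inverse of `α ↦ N ^ #α`. -/
theorem weingarten_convolution {p N : ℕ} (h : p ≤ N) (σ π : Equiv.Perm (Fin p)) :
    ∑ τ : Equiv.Perm (Fin p), weingarten N (σ⁻¹ * τ) * (N : ℝ) ^ cycleCount (τ⁻¹ * π) =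
      if σ = π then 1 else 0 := by
  classical
  let B : Matrix (Equiv.Perm (Fin p)) ((Fin p → Fin N) × (Fin p → Fin N)) ℝ :=
    Matrix.of fun τ fg => if fg.1 ∘ ⇑τ⁻¹ = fg.2 then 1 else 0
  have hB : gramMatrix p N = B * B.conjTranspose := by
    ext a b
    simp only [gramMatrix, B, Matrix.of_apply, Matrix.mul_apply, Matrix.conjTranspose_apply,
      star_trivial, Fintype.sum_prod_type, mul_ite, mul_one, mul_zero, Finset.sum_ite_eq,
      Finset.mem_univ, if_true]
    rw [← Nat.cast_pow, ← card_invariant_eq, Fintype.card_subtype, Finset.card_filter]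
    rw [Nat.cast_sum]
    refine Finset.sum_congr rfl fun f _ => ?_
    have hiff : f ∘ ⇑(a⁻¹ * b) = f ↔ f ∘ ⇑a⁻¹ = f ∘ ⇑b⁻¹ := by
      constructor
      · intro hf
        funext x
        have := congrFun hf (b⁻¹ x)
        simpa using this
      · intro hf
        funext x
        have := congrFun hf (b x)
        simpa using this
    by_cases hf : f ∘ ⇑a⁻¹ = f ∘ ⇑b⁻¹
    · rw [if_pos hf, if_pos (hiff.mpr hf), Nat.cast_one]
    · rw [if_neg hf, if_neg (fun hh => hf (hiff.mp hh)), Nat.cast_zero]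
  have hinj : ∀ v, (gramMatrix p N).mulVec v = 0 → v = 0 := by
    intro v hv
    rw [hB, Matrix.self_mul_conjTranspose_mulVec_eq_zero] at hv
    funext ρ
    have := congrFun hv (Fin.castLE h, Fin.castLE h ∘ ⇑ρ⁻¹)
    simp only [B, Matrix.mulVec, dotProduct, Matrix.conjTranspose_apply, Matrix.of_apply,
      star_trivial, ite_mul, one_mul, zero_mul, Pi.zero_apply] at this
    rw [Finset.sum_eq_single ρ] at this
    · simpa using this
    · intro b _ hb
      rw [if_neg]
      intro hh
      apply hb
      have h2 := (Fin.castLE_injective h).comp_left hh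
      exact inv_injective (Equiv.coe_fn_injective h2)
    · simp
  have hu : IsUnit (gramMatrix p N) := by
    rw [← Matrix.mulVec_injective_iff_isUnit]
    intro v w hvw
    have := hinj (v - w) (by rw [Matrix.mulVec_sub]; exact sub_eq_zero.mpr hvw)
    exact sub_eq_zero.mp this
  have hWG : cfc (fun x : ℝ => x⁻¹) (gramMatrix p N) * gramMatrix p N = 1 := by
    apply hu.mul_left_cancel
    rw [← mul_assoc, (gramMatrix_penrose p N).1, mul_one]
  have := congrFun (congrFun hWG σ) π
  simp only [Matrix.mul_apply, pinv_gramMatrix_apply] at this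
  simpa only [gramMatrix, Matrix.of_apply, Matrix.one_apply] using this

/-- Entrywise (equivalently, Borel) measurable structure on complex matrices. -/
noncomputable instance matrixMeasurableSpace {m n : Type*} : MeasurableSpace (Matrix m n ℂ) :=
  inferInstanceAs (MeasurableSpace (m → n → ℂ))

/-- `V` is a Haar-distributed random isometry `ℂ^d → ℂ^k ⊗ ℂ^n` on the probability space
`(Ω, P)`: its law is the (unique) probability measure on isometries that is invariant under
`V ↦ U₂ V U₁` for all unitaries `U₁ ∈ U(d)`, `U₂ ∈ U(kn)`. -/
structure IsHaarIsometry {Ω : Type*} [MeasurableSpace Ω] (P : MeasureTheory.Measure Ω)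
    {d k n : ℕ} (V : Ω → Matrix (Fin k × Fin n) (Fin d) ℂ) : Prop where
  aemeasurable : AEMeasurable V P
  isometry : ∀ᵐ ω ∂P, (V ω).conjTranspose * V ω = 1
  invariant : ∀ U₁ ∈ Matrix.unitaryGroup (Fin d) ℂ,
    ∀ U₂ ∈ Matrix.unitaryGroup (Fin k × Fin n) ℂ,
      MeasureTheory.Measure.map (fun ω => U₂ * V ω * U₁) P = MeasureTheory.Measure.map V P

/-- The unital completely positive map `Φ(X) = V^* (X ⊗ I_n) V`. -/
def stinespringMap {d k n : ℕ} (V : Matrix (Fin k × Fin n) (Fin d) ℂ)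
    (X : Matrix (Fin k) (Fin k) ℂ) : Matrix (Fin d) (Fin d) ℂ :=
  V.conjTranspose * Matrix.kroneckerMap (· * ·) X (1 : Matrix (Fin n) (Fin n) ℂ) * V

/-- The effects `M_i = Φ(|e_i⟩⟨e_i|)` for an orthonormal basis `e` of `ℂ^k`. -/
noncomputable def povmEffect {d k n : ℕ}
    (e : OrthonormalBasis (Fin k) ℂ (EuclideanSpace ℂ (Fin k)))
    (V : Matrix (Fin k × Fin n) (Fin d) ℂ) (i : Fin k) : Matrix (Fin d) (Fin d) ℂ :=
  stinespringMap V (Matrix.vecMulVec (e i).ofLp (star (e i).ofLp))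

/-- Haar-distributed random isometries exist whenever `d ≤ kn`. -/
theorem exists_isHaarIsometry {d k n : ℕ} (h : d ≤ k * n) :
    ∃ P : MeasureTheory.Measure (Matrix (Fin k × Fin n) (Fin d) ℂ),
      MeasureTheory.IsProbabilityMeasure P ∧ IsHaarIsometry P id := by
  classical
  let G := Matrix.unitaryGroup (Fin k × Fin n) ℂ
  have hcpt : CompactSpace G := by
    refine isCompact_iff_compactSpace.mp (?_ : IsCompact (Matrix.unitaryGroup (Fin k × Fin n) ℂ :
      Set (Matrix (Fin k × Fin n) (Fin k × Fin n) ℂ)))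
    have hcl : IsClosed (Matrix.unitaryGroup (Fin k × Fin n) ℂ :
        Set (Matrix (Fin k × Fin n) (Fin k × Fin n) ℂ)) := isClosed_unitary
    have hK : IsCompact (Set.univ.pi fun _ : Fin k × Fin n =>
        Set.univ.pi fun _ : Fin k × Fin n => Metric.closedBall (0 : ℂ) 1) :=
      isCompact_univ_pi fun _ => isCompact_univ_pi fun _ => isCompact_closedBall _ _
    refine IsCompact.of_isClosed_subset hK hcl ?_
    intro U hU i _ j _
    rw [mem_closedBall_zero_iff]
    exact entry_norm_bound_of_unitary hU i j
  let _ : MeasurableSpace G := borel G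
  have _ : BorelSpace G := ⟨rfl⟩
  let K : TopologicalSpace.PositiveCompacts G := ⊤
  let μ := MeasureTheory.Measure.haarMeasure K
  have hμ : MeasureTheory.IsProbabilityMeasure μ := ⟨by
    have := MeasureTheory.Measure.haarMeasure_self (K₀ := K)
    simpa [K] using this⟩
  have hBorel : BorelSpace (Matrix (Fin k × Fin n) (Fin d) ℂ) :=
    inferInstanceAs (BorelSpace (Fin k × Fin n → Fin d → ℂ))
  let ι : Fin d → Fin k × Fin n := fun i => finProdFinEquiv.symm (Fin.castLE h i)
  have hι : Function.Injective ι :=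
    finProdFinEquiv.symm.injective.comp (Fin.castLE_injective h)
  let J : Matrix (Fin k × Fin n) (Fin d) ℂ := Matrix.of fun a b => if a = ι b then 1 else 0
  have hJ : J.conjTranspose * J = 1 := by
    ext a b
    simp only [J, Matrix.mul_apply, Matrix.conjTranspose_apply, Matrix.of_apply]
    simp [Matrix.one_apply, hι.eq_iff, eq_comm]
  let T : G → Matrix (Fin k × Fin n) (Fin d) ℂ := fun U => U.1 * J
  have hTc : Continuous T := by
    exact continuous_subtype_val.matrix_mul continuous_const
  have hT : Measurable T := hTc.measurable
  refine ⟨μ.map T, MeasureTheory.Measure.isProbabilityMeasure_map hT.aemeasurable,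
    measurable_id.aemeasurable, ?_, ?_⟩
  · rw [MeasureTheory.ae_map_iff hT.aemeasurable]
    · refine Filter.Eventually.of_forall fun U => ?_
      have hU : U.1.conjTranspose * U.1 = 1 := Matrix.mem_unitaryGroup_iff'.mp U.2
      simp only [T, id, Matrix.conjTranspose_mul]
      rw [Matrix.mul_assoc, ← Matrix.mul_assoc _ U.1, hU, Matrix.one_mul, hJ]
    · refine (isClosed_eq ?_ continuous_const).measurableSet
      exact continuous_id.matrix_conjTranspose.matrix_mul continuous_id
  · intro U₁ hU₁ U₂ hU₂
    have hU₁a : U₁ * U₁.conjTranspose = 1 := Matrix.mem_unitaryGroup_iff.mp hU₁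
    let R : Matrix (Fin k × Fin n) (Fin k × Fin n) ℂ :=
      J * U₁ * J.conjTranspose + (1 - J * J.conjTranspose)
    have hRJ : R * J = J * U₁ := by
      simp only [R, Matrix.add_mul, Matrix.sub_mul, Matrix.mul_assoc, hJ, Matrix.mul_one,
        Matrix.one_mul, sub_self, add_zero]
    have hJR : J.conjTranspose * R.conjTranspose = U₁.conjTranspose * J.conjTranspose := by
      rw [← Matrix.conjTranspose_mul, hRJ, Matrix.conjTranspose_mul]
    have hR : R ∈ Matrix.unitaryGroup (Fin k × Fin n) ℂ := by
      rw [Matrix.mem_unitaryGroup_iff, Matrix.star_eq_conjTranspose]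
      have e1 : R * R.conjTranspose = J * U₁ * (J.conjTranspose * R.conjTranspose) +
          (R.conjTranspose - J * (J.conjTranspose * R.conjTranspose)) := by
        conv_lhs => enter [1]; unfold R
        simp only [Matrix.add_mul, Matrix.sub_mul, Matrix.mul_assoc, Matrix.one_mul]
      have e2 : R.conjTranspose =
          J * U₁.conjTranspose * J.conjTranspose + (1 - J * J.conjTranspose) := by
        simp only [R, Matrix.conjTranspose_add, Matrix.conjTranspose_sub,
          Matrix.conjTranspose_mul, Matrix.conjTranspose_conjTranspose,
          Matrix.conjTranspose_one, Matrix.mul_assoc]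
      rw [e1, hJR, e2]
      have e3 : J * U₁ * (U₁.conjTranspose * J.conjTranspose) = J * J.conjTranspose := by
        rw [Matrix.mul_assoc, ← Matrix.mul_assoc U₁, hU₁a, Matrix.one_mul]
      rw [e3, Matrix.mul_assoc]
      abel
    have hm : Measurable fun V : Matrix (Fin k × Fin n) (Fin d) ℂ => U₂ * V * U₁ :=
      ((continuous_const.matrix_mul continuous_id).matrix_mul continuous_const).measurable
    change ((μ.map T).map fun V => U₂ * V * U₁) = (μ.map T).map id
    rw [MeasureTheory.Measure.map_id, MeasureTheory.Measure.map_map hm hT]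
    let g : G := ⟨U₂, hU₂⟩
    let r : G := ⟨R, hR⟩
    have hcomp : (fun V => U₂ * V * U₁) ∘ T = T ∘ (fun U => g * U) ∘ (fun U => U * r) := by
      funext U
      change U₂ * (U.1 * J) * U₁ = (U₂ * (U.1 * R)) * J
      rw [Matrix.mul_assoc U₂, Matrix.mul_assoc U.1, ← hRJ]
      simp only [Matrix.mul_assoc]
    have hl : Measurable fun U : G => g * U := (continuous_const_mul g).measurable
    have hr : Measurable fun U : G => U * r := (continuous_mul_const r).measurable
    have hrp : MeasureTheory.IsProbabilityMeasure (μ.map fun U => U * r) :=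
      MeasureTheory.Measure.isProbabilityMeasure_map hr.aemeasurable
    have hrinv : μ.map (fun U => U * r) = μ :=
      MeasureTheory.Measure.isHaarMeasure_eq_of_isProbabilityMeasure _ _
    rw [hcomp, ← MeasureTheory.Measure.map_map hT (hl.comp hr),
      ← MeasureTheory.Measure.map_map hl hr, hrinv, MeasureTheory.map_mul_left_eq_self]

/-!
Let `Q = V V^*` be the projection of `ℂ^k ⊗ ℂ^n` onto the range of `V`. By cyclicity of the trace,
`Tr M_i^p = Tr (E_i Q)^p` with `E_i = |e_i⟩⟨e_i| ⊗ I_n`, which pairs `E_i ⊗ ⋯ ⊗ E_i` with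
`Q ⊗ ⋯ ⊗ Q` up to a cyclic shift of the tensor factors; likewise for `Tr M_i M_j`. So everything
is read off from `T = E[Q ⊗ ⋯ ⊗ Q]` (`IsHaarIsometry.momentMatrix`).

Invariance of the law under `V ↦ U V` makes `T` commute with all `U ⊗ ⋯ ⊗ U`, `U` unitary. By
Schur–Weyl duality (`exists_perm_combination`) `T` is a linear combination of permutations of the
tensor factors. Duality is proved by enlarging the set of matrices with which `T` commutes: from
unitary tensor powers to diagonal ones, hence to Hermitian ones by the spectral theorem, hence by
polarization to the whole commutant of `S_p`; the Jacobson density theorem, applied to the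
semisimple `ℂ[S_p]`-module `(ℂ^N)^{⊗p}`, then puts `T` into the image of `ℂ[S_p]`.

The traces of `T` against permutations are the powers `d ^ #σ`
(`IsHaarIsometry.sum_momentMatrix_comp`), because `Q` is almost surely a projection of rank `d`.
They determine the coefficients of `T` up to the kernel of the matrix `N ^ #(σ⁻¹τ)`, `N = kn`. This
is the Gram matrix of the permutation operators, so its kernel consists of the linear relations
between them, and applying the pseudo-inverse gives the right pairing with any operator, also when
`p > N` (`weingarten_expansion`). Finally `E_i` is a projection of rank `n`, so its own traces
against permutations are the powers `n ^ #α`, while `E_i E_j = 0` leaves only the identity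
permutation in the mixed second moment.
-/

/-! ### Polarization of multilinear maps -/

/-- The sum of `∏ m, ε m * ∏ l, ε (φ l)` over all signs `ε` vanishes unless `φ` is onto. -/
theorem sum_signs_eq_zero_of_not_surjective {p : ℕ} (φ : Fin p → Fin p)
    (hφ : ¬ Function.Surjective φ) :
    ∑ ε : Fin p → ℤˣ, (((∏ m, ε m) * ∏ l, ε (φ l) : ℤˣ) : ℤ) = 0 := by
  obtain ⟨m₀, hm₀⟩ : ∃ m₀, ∀ l, φ l ≠ m₀ := by
    simpa [Function.Surjective] using hφ
  -- Flipping the sign at a point outside the range of `φ` is a sign-reversing involution.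
  refine Finset.sum_involution (fun ε _ => Function.update ε m₀ (-ε m₀)) ?_ ?_ ?_ ?_
  · intro ε _
    have h1 : ∏ m, Function.update ε m₀ (-ε m₀) m = -∏ m, ε m := by
      rw [Finset.prod_update_of_mem (Finset.mem_univ _), neg_mul, ← Finset.erase_eq,
        Finset.mul_prod_erase _ _ (Finset.mem_univ m₀)]
    have h2 : ∏ l, Function.update ε m₀ (-ε m₀) (φ l) = ∏ l, ε (φ l) :=
      Finset.prod_congr rfl fun l _ => Function.update_of_ne (hm₀ l) _ _
    rw [h1, h2]
    simp
  · intro ε _ _ h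
    have := congrFun h m₀
    rw [Function.update_self] at this
    exact units_ne_neg_self _ this.symm
  · simp
  · intro ε _
    simp

/-- Polarization: the symmetrization of a multilinear map vanishes at `x` as soon as the map
vanishes on the diagonal at all signed sums of the `x m`. -/
theorem MultilinearMap.sum_perm_eq_zero {M N : Type*} [AddCommGroup M] [Module ℂ M]
    [AddCommGroup N] [Module ℂ N] {p : ℕ} (Φ : MultilinearMap ℂ (fun _ : Fin p => M) N)
    (x : Fin p → M)
    (h : ∀ ε : Fin p → ℤˣ, Φ (fun _ => ∑ m, ((ε m : ℤ) : ℂ) • x m) = 0) :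
    ∑ σ : Equiv.Perm (Fin p), Φ (x ∘ σ) = 0 := by
  have h1 : ∀ ε : Fin p → ℤˣ,
      ∑ φ : Fin p → Fin p, ((((∏ m, ε m) * ∏ l, ε (φ l) : ℤˣ) : ℤ) : ℂ) • Φ (x ∘ φ) = 0 := by
    intro ε
    have := h ε
    rw [Φ.map_sum] at this
    simp only [Φ.map_smul_univ] at this
    have h2 := congrArg (fun v => (((∏ m, ε m : ℤˣ) : ℤ) : ℂ) • v) this
    simp only [smul_zero, Finset.smul_sum, smul_smul] at h2
    rw [← h2]
    refine Finset.sum_congr rfl fun φ _ => ?_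
    push_cast
    rfl
  -- Averaging over all signs leaves only the terms with `φ` bijective.
  have h2 := Finset.sum_eq_zero fun (ε : Fin p → ℤˣ) (_ : ε ∈ Finset.univ) => h1 ε
  rw [Finset.sum_comm] at h2
  simp only [← Finset.sum_smul, ← Int.cast_sum] at h2
  rw [← Finset.sum_filter_add_sum_filter_not Finset.univ
    (fun φ : Fin p → Fin p => Function.Bijective φ)] at h2
  rw [Finset.sum_eq_zero (s := Finset.univ.filter fun φ : Fin p → Fin p => ¬ _), add_zero] at h2
  · have h3 : ∑ σ : Equiv.Perm (Fin p), ((2 : ℂ) ^ p) • Φ (x ∘ σ) = 0 := by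
      rw [← h2]
      refine Finset.sum_bij (fun σ _ => ⇑σ) ?_ ?_ ?_ ?_
      · intro σ _
        exact Finset.mem_filter.mpr ⟨Finset.mem_univ _, σ.bijective⟩
      · intro σ _ τ _ hh
        exact Equiv.coe_fn_injective hh
      · intro φ hφ
        exact ⟨Equiv.ofBijective φ (Finset.mem_filter.mp hφ).2, Finset.mem_univ _, rfl⟩
      · intro σ _
        congr 1
        have : ∀ ε : Fin p → ℤˣ, (∏ m, ε m) * ∏ l, ε (σ l) = 1 := by
          intro ε
          rw [Equiv.prod_comp σ ε, Int.units_mul_self]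
        simp [this]
    rw [← Finset.smul_sum] at h3
    exact (smul_eq_zero.mp h3).resolve_left (pow_ne_zero _ two_ne_zero)
  · intro φ hφ
    rw [sum_signs_eq_zero_of_not_surjective, Int.cast_zero, zero_smul]
    exact fun hs => (Finset.mem_filter.mp hφ).2 ⟨Finite.injective_iff_surjective.mpr hs, hs⟩

/-! ### Tensor powers of matrices -/

section TensorPower

variable {ι : Type*} {p : ℕ}

/-- The matrix of `A₁ ⊗ ⋯ ⊗ A_p`, in the basis of `(ℂ^ι)^{⊗p}` indexed by the multi-indices
`Fin p → ι`, as a multilinear map in the `A_l`. -/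
noncomputable def tensorMatrix (ι : Type*) (p : ℕ) :
    MultilinearMap ℂ (fun _ : Fin p => Matrix ι ι ℂ) (Matrix (Fin p → ι) (Fin p → ι) ℂ) :=
  MultilinearMap.pi fun f => MultilinearMap.pi fun g =>
    (MultilinearMap.mkPiAlgebra ℂ (Fin p) ℂ).compLinearMap
      fun l => Matrix.entryLinearMap ℂ ℂ (f l) (g l)

theorem tensorMatrix_apply (A : Fin p → Matrix ι ι ℂ) (f g : Fin p → ι) :
    tensorMatrix ι p A f g = ∏ l, A l (f l) (g l) := rfl

theorem tensorMatrix_mul [Fintype ι] (A B : Fin p → Matrix ι ι ℂ) :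
    tensorMatrix ι p (fun l => A l * B l) = tensorMatrix ι p A * tensorMatrix ι p B := by
  ext f g
  simp only [tensorMatrix_apply, Matrix.mul_apply, Fintype.prod_sum, Finset.prod_mul_distrib]

theorem tensorMatrix_one [DecidableEq ι] : tensorMatrix ι p (fun _ => 1) = 1 := by
  ext f g
  simp only [tensorMatrix_apply, Matrix.one_apply, Finset.prod_ite_zero, Finset.mem_univ,
    true_imp_iff, Finset.prod_const_one, funext_iff]

theorem tensorMatrix_diagonal [DecidableEq ι] (D : ι → ℂ) :
    tensorMatrix ι p (fun _ => Matrix.diagonal D) = Matrix.diagonal fun f => ∏ l, D (f l) := by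
  ext f g
  simp only [tensorMatrix_apply, Matrix.diagonal_apply, Finset.prod_ite_zero, Finset.mem_univ,
    true_imp_iff, funext_iff]

/-! ### The commutant of the tensor powers of unitary matrices -/

variable [Fintype ι] [DecidableEq ι]

/-- A diagonal tensor power lies in the bicommutant of the unitary ones: entries `T f g ≠ 0` only
occur where `f` and `g` take each value equally often, as is seen from diagonal unitaries with a
single entry, a primitive root of unity of order `p + 1`, different from `1`. -/
theorem commute_tensorMatrix_diagonal {T : Matrix (Fin p → ι) (Fin p → ι) ℂ}
    (hT : ∀ U ∈ Matrix.unitaryGroup ι ℂ, Commute T (tensorMatrix ι p fun _ => U)) (D : ι → ℂ) :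
    Commute T (tensorMatrix ι p fun _ => Matrix.diagonal D) := by
  have hζ := Complex.isPrimitiveRoot_exp (p + 1) (Nat.succ_ne_zero p)
  set ζ := Complex.exp (2 * Real.pi * Complex.I / ((p + 1 : ℕ) : ℂ))
  have key : ∀ f g, T f g ≠ 0 → ∀ i : ι,
      (Finset.univ.filter fun l => f l = i).card = (Finset.univ.filter fun l => g l = i).card := by
    intro f g hfg i
    let z : ι → ℂ := fun j => if j = i then ζ else 1
    have hz : ∀ j, z j * star (z j) = 1 := by
      intro j
      have : ‖z j‖ = 1 := by
        by_cases hj : j = i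
        · simpa [z, hj] using hζ.norm'_eq_one (Nat.succ_ne_zero p)
        · simp [z, hj]
      rw [Complex.star_def, Complex.mul_conj, Complex.normSq_eq_norm_sq, this]
      simp
    have hU : Matrix.diagonal z ∈ Matrix.unitaryGroup ι ℂ := by
      rw [Matrix.mem_unitaryGroup_iff, Matrix.star_eq_conjTranspose,
        Matrix.diagonal_conjTranspose, Matrix.diagonal_mul_diagonal, ← Matrix.diagonal_one]
      congr 1
      funext j
      exact hz j
    have hc := congrFun (congrFun (hT _ hU).eq f) g
    rw [tensorMatrix_diagonal, Matrix.mul_diagonal, Matrix.diagonal_mul, mul_comm] at hc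
    have hc2 := mul_right_cancel₀ hfg hc
    have hcount : ∀ h : Fin p → ι,
        ∏ l, z (h l) = ζ ^ (Finset.univ.filter fun l => h l = i).card := by
      intro h
      simp only [z, Finset.prod_ite, Finset.prod_const, one_pow, mul_one]
    have hle : ∀ h : Fin p → ι, (Finset.univ.filter fun l => h l = i).card < p + 1 := fun h =>
      Nat.lt_succ_of_le ((Finset.card_le_univ _).trans (by simp))
    rw [hcount, hcount] at hc2
    exact (hζ.pow_inj (hle _) (hle _) hc2).symm
  have hprod : ∀ h : Fin p → ι,
      ∏ l, D (h l) = ∏ i, D i ^ (Finset.univ.filter fun l => h l = i).card := by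
    intro h
    rw [← Finset.prod_fiberwise' Finset.univ h D]
    simp
  change T * _ = _ * T
  ext f g
  rw [tensorMatrix_diagonal, Matrix.mul_diagonal, Matrix.diagonal_mul, mul_comm]
  by_cases hfg : T f g = 0
  · simp [hfg]
  · congr 1
    rw [hprod, hprod]
    exact Finset.prod_congr rfl fun i _ => by rw [key f g hfg i]

theorem commute_tensorMatrix_hermitian {T : Matrix (Fin p → ι) (Fin p → ι) ℂ}
    (hT : ∀ U ∈ Matrix.unitaryGroup ι ℂ, Commute T (tensorMatrix ι p fun _ => U))
    {A : Matrix ι ι ℂ} (hA : A.IsHermitian) :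
    Commute T (tensorMatrix ι p fun _ => A) := by
  rw [hA.spectral_theorem, Unitary.conjStarAlgAut_apply, tensorMatrix_mul, tensorMatrix_mul]
  exact ((hT _ hA.eigenvectorUnitary.2).mul_right (commute_tensorMatrix_diagonal hT _)).mul_right
    (hT _ (Unitary.star_mem hA.eigenvectorUnitary.2))

/-- Polarization from Hermitian tensor powers to symmetrized elementary tensors; the Hermitian
matrices span all matrices over `ℂ`. -/
theorem commute_sum_tensorMatrix {T : Matrix (Fin p → ι) (Fin p → ι) ℂ}
    (hT : ∀ U ∈ Matrix.unitaryGroup ι ℂ, Commute T (tensorMatrix ι p fun _ => U))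
    (A : Fin p → Matrix ι ι ℂ) :
    Commute T (∑ σ : Equiv.Perm (Fin p), tensorMatrix ι p (A ∘ σ)) := by
  let c : Matrix (Fin p → ι) (Fin p → ι) ℂ →ₗ[ℂ] Matrix (Fin p → ι) (Fin p → ι) ℂ :=
    LinearMap.mulLeft ℂ T - LinearMap.mulRight ℂ T
  let Φ := c.compMultilinearMap (tensorMatrix ι p)
  let Ψ := ∑ σ : Equiv.Perm (Fin p), Φ.domDomCongr σ
  have hΨ : ∀ A : Fin p → Matrix ι ι ℂ, Ψ A = ∑ σ : Equiv.Perm (Fin p), Φ (A ∘ σ) := by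
    intro A
    simp only [Ψ, sum_apply]
    rfl
  have hspan : ⊤ ≤ Submodule.span ℂ (selfAdjoint (Matrix ι ι ℂ) : Set (Matrix ι ι ℂ)) :=
    span_selfAdjoint.ge
  have hΨ0 : Ψ = 0 := by
    refine Module.Basis.ext_multilinear (fun _ => Module.Basis.ofSpan hspan) fun v => ?_
    rw [hΨ, zero_apply]
    refine Φ.sum_perm_eq_zero _ fun ε => ?_
    have hherm : ∀ m, Module.Basis.ofSpan hspan (v m) ∈ selfAdjoint (Matrix ι ι ℂ) := fun m =>
      Module.Basis.ofSpan_subset hspan (Set.mem_range_self _)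
    refine sub_eq_zero.mpr (commute_tensorMatrix_hermitian hT ?_).eq
    refine (sum_mem fun m _ => ?_ : _ ∈ selfAdjoint (Matrix ι ι ℂ))
    rw [Int.cast_smul_eq_zsmul]
    exact zsmul_mem (hherm m) _
  have := hΨ A
  rw [hΨ0, zero_apply] at this
  refine sub_eq_zero.mp ?_
  rw [Finset.mul_sum, Finset.sum_mul, ← Finset.sum_sub_distrib]
  exact this.symm

/-- What commutes with all tensor powers of unitary matrices commutes with every matrix that is
invariant under simultaneous permutations of the tensor factors. -/
theorem commute_of_perm_invariant {T : Matrix (Fin p → ι) (Fin p → ι) ℂ}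
    (hT : ∀ U ∈ Matrix.unitaryGroup ι ℂ, Commute T (tensorMatrix ι p fun _ => U))
    {X : Matrix (Fin p → ι) (Fin p → ι) ℂ}
    (hX : ∀ (σ : Equiv.Perm (Fin p)) (f g : Fin p → ι), X (f ∘ σ) (g ∘ σ) = X f g) :
    Commute T X := by
  have hsingle : ∀ f g : Fin p → ι,
      tensorMatrix ι p (fun l => Matrix.single (f l) (g l) 1) = Matrix.single f g 1 := by
    intro f g
    ext a b
    simp only [tensorMatrix_apply, Matrix.single_apply, Finset.prod_ite_zero, Finset.mem_univ,
      true_imp_iff, Finset.prod_const_one, funext_iff, forall_and]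
  -- Up to the factor `p!`, the invariant matrix `X` is a sum of symmetrized elementary tensors.
  have h1 : ((Nat.factorial p : ℕ) : ℂ) • X = ∑ f : Fin p → ι, ∑ g : Fin p → ι,
      X f g • ∑ σ : Equiv.Perm (Fin p),
        tensorMatrix ι p ((fun l => Matrix.single (f l) (g l) 1) ∘ σ) := by
    have h2 : ∀ σ : Equiv.Perm (Fin p), X = ∑ f : Fin p → ι, ∑ g : Fin p → ι,
        X f g • Matrix.single (f ∘ σ) (g ∘ σ) (1 : ℂ) := by
      intro σ
      conv_lhs => rw [Matrix.matrix_eq_sum_single X]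
      rw [← Equiv.sum_comp (Equiv.arrowCongr σ.symm (Equiv.refl ι))]
      refine Finset.sum_congr rfl fun f _ => ?_
      rw [← Equiv.sum_comp (Equiv.arrowCongr σ.symm (Equiv.refl ι))]
      refine Finset.sum_congr rfl fun g _ => ?_
      have : ∀ f : Fin p → ι, (Equiv.arrowCongr σ.symm (Equiv.refl ι)) f = f ∘ σ := fun f => rfl
      rw [this, this, hX, Matrix.smul_single, smul_eq_mul, mul_one]
    calc ((Nat.factorial p : ℕ) : ℂ) • X = ∑ σ : Equiv.Perm (Fin p), X := by
          rw [Finset.sum_const, Finset.card_univ, Fintype.card_perm, Fintype.card_fin,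
            Nat.cast_smul_eq_nsmul]
      _ = ∑ σ : Equiv.Perm (Fin p), ∑ f : Fin p → ι, ∑ g : Fin p → ι,
        X f g • Matrix.single (f ∘ σ) (g ∘ σ) (1 : ℂ) := Finset.sum_congr rfl fun σ _ => h2 σ
      _ = _ := by
        rw [Finset.sum_comm]
        refine Finset.sum_congr rfl fun f _ => ?_
        rw [Finset.sum_comm]
        refine Finset.sum_congr rfl fun g _ => ?_
        rw [Finset.smul_sum]
        refine Finset.sum_congr rfl fun σ _ => ?_
        congr 1
        exact (hsingle (f ∘ σ) (g ∘ σ)).symm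
  have h3 : Commute T (((Nat.factorial p : ℕ) : ℂ) • X) := by
    rw [h1]
    exact Commute.sum_right _ _ _ fun f _ => Commute.sum_right _ _ _ fun g _ =>
      (commute_sum_tensorMatrix hT _).smul_right _
  exact (Commute.smul_right_iff₀ (by exact_mod_cast Nat.factorial_ne_zero p)).mp h3

/-- The action of `S_p` on `(ℂ^ι)^{⊗p}` by permutation of the tensor factors, on coordinates. -/
def tensorPermRep (ι : Type*) (p : ℕ) :
    Representation ℂ (Equiv.Perm (Fin p)) ((Fin p → ι) → ℂ) where
  toFun σ := LinearMap.funLeft ℂ ℂ fun f => f ∘ σ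
  map_one' := rfl
  map_mul' _ _ := rfl

/-- **Schur–Weyl duality**: a matrix commuting with all `U ⊗ ⋯ ⊗ U`, `U` unitary, is a linear
combination of permutations of the tensor factors. -/
theorem exists_perm_combination {T : Matrix (Fin p → ι) (Fin p → ι) ℂ}
    (hT : ∀ U ∈ Matrix.unitaryGroup ι ℂ, Commute T (tensorMatrix ι p fun _ => U)) :
    ∃ c : Equiv.Perm (Fin p) → ℂ, ∀ f g : Fin p → ι,
      T f g = ∑ σ, c σ * if f ∘ σ = g then 1 else 0 := by
  let ρ := tensorPermRep ι p
  let R := MonoidAlgebra ℂ (Equiv.Perm (Fin p))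
  have hne : NeZero (Nat.card (Equiv.Perm (Fin p)) : ℂ) :=
    ⟨by exact_mod_cast Nat.card_pos.ne'⟩
  have hsmul : ∀ (σ : Equiv.Perm (Fin p)) (w : ρ.asModule),
      MonoidAlgebra.single σ (1 : ℂ) • w = ρ σ w := fun σ w =>
    (ρ.single_smul 1 σ w).trans (one_smul ℂ _)
  -- `T` commutes with every `ℂ[S_p]`-linear endomorphism, as the matrix of such an endomorphism is
  -- invariant under simultaneous permutations of the tensor factors.
  have hlin : ∀ φ : Module.End R ρ.asModule, ∀ v : (Fin p → ι) → ℂ,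
      T.mulVec (φ v) = φ (T.mulVec v) := by
    intro φ v
    let φ' : ((Fin p → ι) → ℂ) →ₗ[ℂ] ((Fin p → ι) → ℂ) := φ.restrictScalars ℂ
    have hφ : ∀ (σ : Equiv.Perm (Fin p)) w, φ' (ρ σ w) = ρ σ (φ' w) := fun σ w =>
      (congrArg φ (hsmul σ w)).symm.trans
        ((φ.map_smul (MonoidAlgebra.single σ (1 : ℂ)) w).trans (hsmul σ (φ w)))
    let X : Matrix (Fin p → ι) (Fin p → ι) ℂ := LinearMap.toMatrix' φ'
    have hX : ∀ w, X.mulVec w = φ' w := fun w => LinearMap.toMatrix'_mulVec φ' w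
    have hXapp : ∀ f g, X f g = φ' (Pi.single g 1) f := fun f g => by
      rw [← hX, Matrix.mulVec_single_one, Matrix.col_apply]
    have hinv : ∀ (σ : Equiv.Perm (Fin p)) (f g : Fin p → ι), X (f ∘ σ) (g ∘ σ) = X f g := by
      intro σ f g
      have h1 := congrFun (hφ σ (Pi.single (g ∘ σ) 1)) f
      have h2 : ρ σ (Pi.single (g ∘ σ) 1) = Pi.single g 1 := by
        funext h
        change (Pi.single (g ∘ σ) 1 : (Fin p → ι) → ℂ) (h ∘ σ) = _
        simp only [Pi.single_apply, σ.surjective.injective_comp_right.eq_iff]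
      rw [h2] at h1
      rw [hXapp, hXapp]
      exact h1.symm
    have hc := (commute_of_perm_invariant hT hinv).eq
    change T.mulVec (φ' v) = φ' (T.mulVec v)
    rw [← hX, ← hX, Matrix.mulVec_mulVec, Matrix.mulVec_mulVec, hc]
  let F : Module.End (Module.End R ρ.asModule) ρ.asModule :=
    { toFun := fun v => T.mulVec v
      map_add' := fun v w => T.mulVec_add v w
      map_smul' := hlin }
  classical
  obtain ⟨r, hr⟩ := jacobson_density F
    (Finset.univ.image fun g : Fin p → ι => (Pi.single g 1 : (Fin p → ι) → ℂ))
  refine ⟨fun σ => r.coeff σ, fun f g => ?_⟩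
  have h1 := hr _ (Finset.mem_image_of_mem _ (Finset.mem_univ g))
  have h2 : T.mulVec (Pi.single g 1) = ρ.asAlgebraHom r (Pi.single g 1) :=
    h1.trans (ρ.asModuleEquiv_map_smul r (Pi.single g 1 : (Fin p → ι) → ℂ))
  have h3 := congrFun h2 f
  rw [Representation.asAlgebraHom_def, MonoidAlgebra.lift_apply, Matrix.mulVec_single_one,
    Matrix.col_apply, Finsupp.sum_fintype r.coeff (fun a b => b • ρ a) (fun _ => zero_smul ℂ _),
    LinearMap.sum_apply,
    Finset.sum_apply] at h3
  rw [h3]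
  refine Finset.sum_congr rfl fun σ _ => ?_
  change r.coeff σ * (Pi.single g 1 : (Fin p → ι) → ℂ) (f ∘ σ) = _
  rw [Pi.single_apply]

end TensorPower

/-! ### Counting functions invariant under a permutation -/

theorem sum_ite_comp_eq_self {κ : Type*} [Fintype κ] [DecidableEq κ] {p : ℕ}
    (σ : Equiv.Perm (Fin p)) :
    ∑ f : Fin p → κ, (if f ∘ σ = f then 1 else 0 : ℂ) = (Fintype.card κ : ℂ) ^ cycleCount σ := by
  let E := Fintype.equivFin κ
  rw [Finset.sum_boole, ← Nat.cast_pow, ← card_invariant_eq, ← Fintype.card_subtype]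
  congr 1
  refine Fintype.card_congr ((Equiv.arrowCongr (Equiv.refl _) E).subtypeEquiv fun f => ?_)
  change _ ↔ (E ∘ f) ∘ σ = E ∘ f
  rw [Function.comp_assoc, E.injective.comp_left.eq_iff]

theorem cycleCount_mul_comm {p : ℕ} (σ τ : Equiv.Perm (Fin p)) :
    cycleCount (σ * τ) = cycleCount (τ * σ) := by
  have h : 2 ^ cycleCount (σ * τ) = 2 ^ cycleCount (τ * σ) := by
    rw [← card_invariant_eq, ← card_invariant_eq]
    refine Fintype.card_congr
      ((Equiv.arrowCongr σ.symm (Equiv.refl (Fin 2))).subtypeEquiv fun f => ?_)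
    change f ∘ (σ ∘ τ) = f ↔ (f ∘ σ) ∘ (τ ∘ σ) = f ∘ σ
    rw [← Function.comp_assoc f, ← Function.comp_assoc (f ∘ σ),
      (σ.surjective.injective_comp_right (γ := Fin 2)).eq_iff]
  exact Nat.pow_right_injective le_rfl h

theorem sum_ite_comp_eq_comp {κ : Type*} [Fintype κ] [DecidableEq κ] {p : ℕ}
    (σ τ : Equiv.Perm (Fin p)) :
    ∑ f : Fin p → κ, (if f ∘ σ = f ∘ τ then 1 else 0 : ℂ) =
      (Fintype.card κ : ℂ) ^ cycleCount (σ⁻¹ * τ) := by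
  rw [cycleCount_mul_comm, ← cycleCount_inv, mul_inv_rev, inv_inv, ← sum_ite_comp_eq_self]
  refine Finset.sum_congr rfl fun f _ => ?_
  refine if_congr ?_ rfl rfl
  constructor
  · intro h
    funext x
    have := congrFun h (τ⁻¹ x)
    simpa using this
  · intro h
    funext x
    have := congrFun h (τ x)
    simpa using this

/-- The trace of a permutation of the tensor factors against `P ⊗ ⋯ ⊗ P`, where `P = W W^*` is the
projection onto the range of the isometry `W`, is a power of the rank of `P`. -/
theorem sum_prod_isometry_projection {ι κ : Type*} [Fintype ι] [Fintype κ] [DecidableEq κ] {p : ℕ}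
    {W : Matrix ι κ ℂ} (hW : W.conjTranspose * W = 1) (σ : Equiv.Perm (Fin p)) :
    ∑ f : Fin p → ι, ∏ l, (W * W.conjTranspose) (f l) (f (σ l)) =
      (Fintype.card κ : ℂ) ^ cycleCount σ := by
  have h1 : ∀ f : Fin p → ι, ∏ l, (W * W.conjTranspose) (f l) (f (σ l)) =
      ∑ x : Fin p → κ, ∏ l, W.conjTranspose (x (σ⁻¹ l)) (f l) * W (f l) (x l) := by
    intro f
    simp only [Matrix.mul_apply, Fintype.prod_sum, Finset.prod_mul_distrib]
    refine Finset.sum_congr rfl fun x _ => ?_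
    rw [mul_comm]
    congr 1
    rw [← Equiv.prod_comp σ (fun l => W.conjTranspose (x (σ⁻¹ l)) (f l))]
    simp
  have h2 : ∀ x : Fin p → κ, ∑ f : Fin p → ι,
      ∏ l, W.conjTranspose (x (σ⁻¹ l)) (f l) * W (f l) (x l) =
        if x ∘ ⇑σ⁻¹ = x then 1 else 0 := by
    intro x
    rw [← Fintype.prod_sum fun l a => W.conjTranspose (x (σ⁻¹ l)) a * W a (x l)]
    simp only [← Matrix.mul_apply, hW, Matrix.one_apply, Finset.prod_ite_zero, Finset.mem_univ,
      true_imp_iff, Finset.prod_const_one, funext_iff, Function.comp_apply]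
  simp only [h1]
  rw [Finset.sum_comm]
  simp only [h2]
  rw [sum_ite_comp_eq_self, cycleCount_inv]

/-! ### Traces of products as sums over closed paths -/

theorem list_ofFn_prod_apply {ι : Type*} [Fintype ι] [DecidableEq ι] {m : ℕ}
    (A : Fin (m + 1) → Matrix ι ι ℂ) (a b : ι) :
    (List.ofFn A).prod a b = ∑ f : Fin m → ι, ∏ l : Fin (m + 1),
      A l ((Fin.cons a f : Fin (m + 1) → ι) l) ((Fin.snoc f b : Fin (m + 1) → ι) l) := by
  induction m generalizing a with
  | zero => simp [Fin.snoc]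
  | succ m ih =>
    rw [List.ofFn_succ, List.prod_cons, Matrix.mul_apply,
      ← (Fin.consEquiv fun _ : Fin (m + 1) => ι).sum_comp, Fintype.sum_prod_type]
    refine Finset.sum_congr rfl fun c _ => ?_
    rw [ih, Finset.mul_sum]
    refine Finset.sum_congr rfl fun f _ => ?_
    conv_rhs => rw [Fin.prod_univ_succ]
    change _ = A 0 a ((Fin.snoc (Fin.cons c f : Fin (m + 1) → ι) b : Fin (m + 2) → ι) 0) *
      ∏ l : Fin (m + 1), A l.succ ((Fin.cons c f : Fin (m + 1) → ι) l)
        ((Fin.snoc (Fin.cons c f : Fin (m + 1) → ι) b : Fin (m + 2) → ι) l.succ)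
    rw [← Fin.cons_snoc_eq_snoc_cons]
    rfl

theorem trace_list_ofFn_prod {ι : Type*} [Fintype ι] [DecidableEq ι] {p : ℕ} (hp : 1 ≤ p)
    (A : Fin p → Matrix ι ι ℂ) :
    (List.ofFn A).prod.trace = ∑ f : Fin p → ι, ∏ l, A l (f l) (f (finRotate p l)) := by
  obtain ⟨m, rfl⟩ : ∃ m, p = m + 1 := ⟨p - 1, by omega⟩
  rw [← (Fin.consEquiv fun _ : Fin (m + 1) => ι).sum_comp, Fintype.sum_prod_type]
  refine Finset.sum_congr rfl fun a _ => ?_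
  rw [Matrix.diag_apply, list_ofFn_prod_apply]
  refine Finset.sum_congr rfl fun f _ => ?_
  refine Finset.prod_congr rfl fun l _ => ?_
  congr 1
  change _ = (Fin.cons a f : Fin (m + 1) → ι) (finRotate (m + 1) l)
  refine Fin.lastCases ?_ (fun l => ?_) l
  · rw [Fin.snoc_last, finRotate_last, Fin.cons_zero]
  · rw [Fin.snoc_castSucc, finRotate_apply, Fin.coeSucc_eq_succ, Fin.cons_succ]

/-! ### Inversion by the Weingarten function -/

open scoped ComplexOrder in
/-- A relation `y` in the kernel of the Gram matrix is a linear relation between the permutation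
operators themselves, because the Gram matrix is that of the Hilbert–Schmidt inner product. -/
theorem gramMatrix_kernel {ι : Type*} [Fintype ι] [DecidableEq ι] {p : ℕ}
    {y : Equiv.Perm (Fin p) → ℂ}
    (hy : ((gramMatrix p (Fintype.card ι)).map Complex.ofReal).mulVec y = 0) (g f : Fin p → ι) :
    ∑ α : Equiv.Perm (Fin p), (if g ∘ α = f then 1 else 0) * y α = 0 := by
  let B : Matrix (Equiv.Perm (Fin p)) ((Fin p → ι) × (Fin p → ι)) ℂ :=
    Matrix.of fun α gf => if gf.1 ∘ ⇑α = gf.2 then 1 else 0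
  have hB : (gramMatrix p (Fintype.card ι)).map Complex.ofReal = B * B.conjTranspose := by
    ext α β
    simp only [gramMatrix, B, Matrix.map_apply, Matrix.of_apply, Matrix.mul_apply,
      Matrix.conjTranspose_apply, Fintype.sum_prod_type]
    push_cast
    rw [← sum_ite_comp_eq_comp (κ := ι)]
    refine Finset.sum_congr rfl fun g _ => ?_
    rw [Finset.sum_eq_single (g ∘ α)]
    · by_cases h : g ∘ α = g ∘ β
      · simp [h]
      · simp [h, Ne.symm h]
    · intro f _ hf
      rw [if_neg (Ne.symm hf), zero_mul]
    · simp
  rw [hB, Matrix.self_mul_conjTranspose_mulVec_eq_zero] at hy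
  have := congrFun hy (g, f)
  simp only [B, Matrix.mulVec, dotProduct, Matrix.conjTranspose_apply, Matrix.of_apply,
    Pi.zero_apply, apply_ite star, star_one, star_zero] at this
  exact this

/-- Pairing a combination `T` of permutation operators with a matrix `X`: the coefficients are
recovered from the traces of `T` against the permutations through the pseudo-inverse of the Gram
matrix. When the coefficients are not unique, any two choices differ by a kernel vector, which
does not contribute. -/
theorem weingarten_expansion {ι : Type*} [Fintype ι] [DecidableEq ι] {p : ℕ}
    {T : Matrix (Fin p → ι) (Fin p → ι) ℂ} {c : Equiv.Perm (Fin p) → ℂ}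
    (hT : ∀ g f, T g f = ∑ α, c α * if g ∘ α = f then 1 else 0)
    (X : Matrix (Fin p → ι) (Fin p → ι) ℂ) :
    ∑ f, ∑ g, X f g * T g f =
      ∑ α : Equiv.Perm (Fin p), ∑ β : Equiv.Perm (Fin p),
        (∑ g, X (g ∘ α) g) * (∑ g, T g (g ∘ β)) *
          (weingarten (Fintype.card ι) (α⁻¹ * β) : ℂ) := by
  set G := (gramMatrix p (Fintype.card ι)).map Complex.ofReal with hG
  set W := (cfc (fun x : ℝ => x⁻¹) (gramMatrix p (Fintype.card ι))).map Complex.ofReal with hW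
  have hGWG : G * W * G = G := by
    have h1 := congrArg (fun M => M.map Complex.ofRealHom)
      (gramMatrix_penrose p (Fintype.card ι)).1
    simp only [Matrix.map_mul] at h1
    exact h1
  set b : Equiv.Perm (Fin p) → ℂ := fun α => ∑ g, X (g ∘ α) g with hb
  set D : Equiv.Perm (Fin p) → ℂ := fun β => ∑ g, T g (g ∘ β) with hD
  have hDc : D = G.mulVec c := by
    funext β
    simp only [hD, hT, Matrix.mulVec, dotProduct]
    rw [Finset.sum_comm]
    refine Finset.sum_congr rfl fun α _ => ?_
    rw [← Finset.mul_sum, sum_ite_comp_eq_comp, mul_comm, hG]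
    simp only [gramMatrix, Matrix.map_apply, Matrix.of_apply]
    rw [← cycleCount_inv, mul_inv_rev, inv_inv]
    push_cast
    rfl
  have hpair : ∀ v : Equiv.Perm (Fin p) → ℂ, b ⬝ᵥ v =
      ∑ f, ∑ g, X f g * ∑ α : Equiv.Perm (Fin p), (if g ∘ α = f then 1 else 0) * v α := by
    intro v
    simp only [dotProduct, hb, Finset.mul_sum, Finset.sum_mul]
    rw [Finset.sum_comm]
    conv_rhs => rw [Finset.sum_comm]
    refine Finset.sum_congr rfl fun g _ => ?_
    rw [Finset.sum_comm]
    refine Finset.sum_congr rfl fun α _ => ?_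
    simp
  have hker : G.mulVec (c - (W * G).mulVec c) = 0 := by
    rw [Matrix.mulVec_sub, Matrix.mulVec_mulVec, ← Matrix.mul_assoc, hGWG, sub_self]
  have h0 : b ⬝ᵥ (c - (W * G).mulVec c) = 0 := by
    rw [hpair]
    simp only [gramMatrix_kernel hker, mul_zero, Finset.sum_const_zero]
  have hlhs : ∑ f, ∑ g, X f g * T g f = b ⬝ᵥ c := by
    rw [hpair]
    simp only [hT, mul_comm (c _)]
  rw [hlhs, sub_eq_zero.mp ((dotProduct_sub b _ _).symm.trans h0), ← Matrix.mulVec_mulVec,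
    ← hDc]
  simp only [dotProduct, Matrix.mulVec]
  refine Finset.sum_congr rfl fun α _ => ?_
  rw [Finset.mul_sum]
  refine Finset.sum_congr rfl fun β _ => ?_
  change b α * (W α β * D β) = b α * D β * _
  rw [hW, Matrix.map_apply, pinv_gramMatrix_apply]
  ring

/-! ### Moments of the range projection of a Haar-distributed isometry -/

theorem norm_entry_le_one_of_isometry {ι κ : Type*} [Fintype ι] [DecidableEq κ]
    {W : Matrix ι κ ℂ} (hW : W.conjTranspose * W = 1) (a : ι) (b : κ) : ‖W a b‖ ≤ 1 := by
  have h1 := congrFun (congrFun hW b) b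
  rw [Matrix.mul_apply, Matrix.one_apply_eq] at h1
  have h2 : ∑ a, ‖W a b‖ ^ 2 = 1 := by
    have h3 : ∀ a, W.conjTranspose b a * W a b = ((‖W a b‖ ^ 2 : ℝ) : ℂ) := fun a => by
      rw [Matrix.conjTranspose_apply, Complex.star_def, Complex.conj_mul', Complex.ofReal_pow]
    simp only [h3] at h1
    exact_mod_cast h1
  have h4 : ‖W a b‖ ^ 2 ≤ 1 := h2 ▸ Finset.single_le_sum
    (f := fun a => ‖W a b‖ ^ 2) (fun _ _ => by positivity) (Finset.mem_univ a)
  exact (sq_le_one_iff₀ (norm_nonneg _)).mp h4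

namespace IsHaarIsometry

variable {Ω : Type*} [MeasurableSpace Ω] {P : MeasureTheory.Measure Ω} {d k n : ℕ}
  {V : Ω → Matrix (Fin k × Fin n) (Fin d) ℂ}

theorem aestronglyMeasurable_comp (hV : IsHaarIsometry P V)
    {F : Matrix (Fin k × Fin n) (Fin d) ℂ → ℂ} (hF : Continuous F) :
    MeasureTheory.AEStronglyMeasurable (fun ω => F (V ω)) P := by
  have hBorel : BorelSpace (Matrix (Fin k × Fin n) (Fin d) ℂ) :=
    inferInstanceAs (BorelSpace (Fin k × Fin n → Fin d → ℂ))
  exact (hF.measurable.comp_aemeasurable hV.aemeasurable).aestronglyMeasurable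

theorem integrable_comp [MeasureTheory.IsProbabilityMeasure P] (hV : IsHaarIsometry P V)
    {F : Matrix (Fin k × Fin n) (Fin d) ℂ → ℂ} (hF : Continuous F) :
    MeasureTheory.Integrable (fun ω => F (V ω)) P := by
  have hK : IsCompact (Set.univ.pi fun _ : Fin k × Fin n =>
      Set.univ.pi fun _ : Fin d => Metric.closedBall (0 : ℂ) 1) :=
    isCompact_univ_pi fun _ => isCompact_univ_pi fun _ => isCompact_closedBall _ _
  obtain ⟨C, hC⟩ := hK.exists_bound_of_continuousOn (f := F) hF.continuousOn
  refine MeasureTheory.Integrable.of_bound (hV.aestronglyMeasurable_comp hF) C ?_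
  filter_upwards [hV.isometry] with ω hω
  refine hC _ fun a _ b _ => ?_
  rw [mem_closedBall_zero_iff]
  exact norm_entry_le_one_of_isometry hω a b

theorem integral_comp_mul_left (hV : IsHaarIsometry P V)
    {F : Matrix (Fin k × Fin n) (Fin d) ℂ → ℂ} (hF : Continuous F)
    {U : Matrix (Fin k × Fin n) (Fin k × Fin n) ℂ} (hU : U ∈ Matrix.unitaryGroup _ ℂ) :
    ∫ ω, F (U * V ω) ∂P = ∫ ω, F (V ω) ∂P := by
  have hBorel : BorelSpace (Matrix (Fin k × Fin n) (Fin d) ℂ) :=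
    inferInstanceAs (BorelSpace (Fin k × Fin n → Fin d → ℂ))
  have h1 := hV.invariant 1 (one_mem _) U hU
  simp only [Matrix.mul_one] at h1
  have hUc : Continuous fun V : Matrix (Fin k × Fin n) (Fin d) ℂ => U * V :=
    continuous_const.matrix_mul continuous_id
  have hUm : AEMeasurable (fun ω => U * V ω) P := hUc.measurable.comp_aemeasurable hV.aemeasurable
  rw [← MeasureTheory.integral_map hV.aemeasurable hF.measurable.aestronglyMeasurable, ← h1,
    MeasureTheory.integral_map hUm hF.measurable.aestronglyMeasurable]

/-- The expectation of `Q ⊗ ⋯ ⊗ Q`, where `Q = V V^*` is the projection onto the range of `V`. -/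
noncomputable def momentMatrix (P : MeasureTheory.Measure Ω)
    (V : Ω → Matrix (Fin k × Fin n) (Fin d) ℂ) (p : ℕ) :
    Matrix (Fin p → Fin k × Fin n) (Fin p → Fin k × Fin n) ℂ :=
  Matrix.of fun f g => ∫ ω, tensorMatrix _ p (fun _ => V ω * (V ω).conjTranspose) f g ∂P

theorem continuous_tensorMatrix_mul_conjTranspose {p : ℕ} (f g : Fin p → Fin k × Fin n) :
    Continuous fun W : Matrix (Fin k × Fin n) (Fin d) ℂ =>
      tensorMatrix _ p (fun _ => W * W.conjTranspose) f g := by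
  simp only [tensorMatrix_apply]
  exact continuous_finsetProd _ fun l _ =>
    (continuous_id.matrix_mul continuous_id.matrix_conjTranspose).matrix_elem _ _

theorem commute_momentMatrix [MeasureTheory.IsProbabilityMeasure P] (hV : IsHaarIsometry P V)
    (p : ℕ) {U : Matrix (Fin k × Fin n) (Fin k × Fin n) ℂ} (hU : U ∈ Matrix.unitaryGroup _ ℂ) :
    Commute (momentMatrix P V p) (tensorMatrix _ p fun _ => U) := by
  have hint : ∀ f g : Fin p → Fin k × Fin n, MeasureTheory.Integrable
      (fun ω => tensorMatrix _ p (fun _ => V ω * (V ω).conjTranspose) f g) P := fun f g =>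
    hV.integrable_comp (continuous_tensorMatrix_mul_conjTranspose f g)
  have hconj : tensorMatrix _ p (fun _ => U) * momentMatrix P V p *
      tensorMatrix _ p (fun _ => star U) = momentMatrix P V p := by
    ext f g
    have h1 := hV.integral_comp_mul_left (continuous_tensorMatrix_mul_conjTranspose f g) hU
    change _ = ∫ ω, tensorMatrix _ p (fun _ => V ω * (V ω).conjTranspose) f g ∂P
    rw [← h1]
    have h2 : ∀ ω, tensorMatrix _ p (fun _ => U * V ω * (U * V ω).conjTranspose) f g =
        ∑ y, (∑ x, tensorMatrix _ p (fun _ => U) f x *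
          tensorMatrix _ p (fun _ => V ω * (V ω).conjTranspose) x y) *
            tensorMatrix _ p (fun _ => star U) y g := by
      intro ω
      simp only [← Matrix.mul_apply]
      rw [← tensorMatrix_mul, ← tensorMatrix_mul]
      simp only [Matrix.conjTranspose_mul, Matrix.star_eq_conjTranspose, Matrix.mul_assoc]
    simp only [h2]
    rw [MeasureTheory.integral_finsetSum _ fun y _ =>
      (MeasureTheory.integrable_finsetSum _ fun x _ => (hint x y).const_mul _).mul_const _]
    rw [Matrix.mul_apply]
    refine Finset.sum_congr rfl fun y _ => ?_
    rw [MeasureTheory.integral_mul_const, MeasureTheory.integral_finsetSum _ fun x _ =>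
      (hint x y).const_mul _, Matrix.mul_apply]
    congr 1
    refine Finset.sum_congr rfl fun x _ => ?_
    rw [MeasureTheory.integral_const_mul]
    rfl
  have hinv : tensorMatrix _ p (fun _ => star U) * tensorMatrix _ p (fun _ => U) = 1 := by
    rw [← tensorMatrix_mul, Matrix.mem_unitaryGroup_iff'.mp hU, tensorMatrix_one]
  change _ * _ = _ * _
  conv_lhs => rw [← hconj]
  rw [Matrix.mul_assoc, hinv, Matrix.mul_one]

/-- The traces of `E[Q ⊗ ⋯ ⊗ Q]` against permutations of the tensor factors. -/
theorem sum_momentMatrix_comp [MeasureTheory.IsProbabilityMeasure P] (hV : IsHaarIsometry P V)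
    {p : ℕ} (σ : Equiv.Perm (Fin p)) :
    ∑ f, momentMatrix P V p f (f ∘ σ) = (d : ℂ) ^ cycleCount σ := by
  change ∑ f : Fin p → Fin k × Fin n,
    ∫ ω, tensorMatrix _ p (fun _ => V ω * (V ω).conjTranspose) f (f ∘ σ) ∂P = _
  rw [← MeasureTheory.integral_finsetSum _ fun f _ =>
    hV.integrable_comp (continuous_tensorMatrix_mul_conjTranspose f (f ∘ σ))]
  have h1 : ∀ᵐ ω ∂P, ∑ f : Fin p → Fin k × Fin n,
      tensorMatrix _ p (fun _ => V ω * (V ω).conjTranspose) f (f ∘ σ) =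
        (d : ℂ) ^ cycleCount σ := by
    filter_upwards [hV.isometry] with ω hω
    have := sum_prod_isometry_projection hω σ
    rw [Fintype.card_fin] at this
    exact this
  rw [MeasureTheory.integral_congr_ae h1, MeasureTheory.integral_const]
  simp

theorem integrable_trace_list [MeasureTheory.IsProbabilityMeasure P] (hV : IsHaarIsometry P V)
    {p : ℕ} (hp : 1 ≤ p) (A : Fin p → Matrix (Fin k × Fin n) (Fin k × Fin n) ℂ) :
    MeasureTheory.Integrable
      (fun ω => (List.ofFn fun l => A l * (V ω * (V ω).conjTranspose)).prod.trace) P := by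
  simp only [trace_list_ofFn_prod hp]
  refine hV.integrable_comp (F := fun W => ∑ f : Fin p → Fin k × Fin n,
    ∏ l, (A l * (W * W.conjTranspose)) (f l) (f (finRotate p l))) ?_
  exact continuous_finsetSum _ fun f _ => continuous_finsetProd _ fun l _ =>
    (continuous_const.matrix_mul
      (continuous_id.matrix_mul continuous_id.matrix_conjTranspose)).matrix_elem _ _

/-- The **Weingarten formula** for the expected trace of `A₁ Q A₂ Q ⋯ A_p Q`, where `Q = V V^*` is
the projection onto the range of `V`. The cyclic shift coming from the trace is absorbed into the
coefficients of `E[Q ⊗ ⋯ ⊗ Q]` before they are computed. -/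
theorem integral_trace_list [MeasureTheory.IsProbabilityMeasure P] (hV : IsHaarIsometry P V)
    {p : ℕ} (hp : 1 ≤ p) (A : Fin p → Matrix (Fin k × Fin n) (Fin k × Fin n) ℂ) :
    ∫ ω, (List.ofFn fun l => A l * (V ω * (V ω).conjTranspose)).prod.trace ∂P =
      ∑ α : Equiv.Perm (Fin p), ∑ β : Equiv.Perm (Fin p),
        (∑ g : Fin p → Fin k × Fin n, ∏ l, A l (g (α l)) (g l)) *
          (d : ℂ) ^ cycleCount (β * (fullCycle p)⁻¹) *
            (weingarten (k * n) (α⁻¹ * β) : ℂ) := by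
  have h1 : ∀ ω, (List.ofFn fun l => A l * (V ω * (V ω).conjTranspose)).prod.trace =
      ∑ f, ∑ g, tensorMatrix _ p A f g *
        tensorMatrix _ p (fun _ => V ω * (V ω).conjTranspose) g (f ∘ finRotate p) := by
    intro ω
    rw [trace_list_ofFn_prod hp]
    refine Finset.sum_congr rfl fun f _ => ?_
    simp only [Matrix.mul_apply (M := A _), Fintype.prod_sum, Finset.prod_mul_distrib]
    rfl
  obtain ⟨c, hc⟩ := exists_perm_combination (fun U hU => hV.commute_momentMatrix p hU)
  let T : Matrix (Fin p → Fin k × Fin n) (Fin p → Fin k × Fin n) ℂ :=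
    Matrix.of fun g f => momentMatrix P V p g (f ∘ finRotate p)
  have hT : ∀ g f, T g f = ∑ α : Equiv.Perm (Fin p),
      c (α * finRotate p) * if g ∘ α = f then 1 else 0 := by
    intro g f
    change momentMatrix P V p g (f ∘ finRotate p) = _
    rw [hc, ← Equiv.sum_comp (Equiv.mulRight (finRotate p))]
    refine Finset.sum_congr rfl fun α _ => ?_
    have hinj := (finRotate p).surjective.injective_comp_right (γ := Fin k × Fin n)
    exact congrArg _ (if_congr (hinj.eq_iff (a := g ∘ α) (b := f)) rfl rfl)
  have h2 : ∫ ω, (List.ofFn fun l => A l * (V ω * (V ω).conjTranspose)).prod.trace ∂P =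
      ∑ f, ∑ g, tensorMatrix _ p A f g * T g f := by
    have hint : ∀ f g : Fin p → Fin k × Fin n, MeasureTheory.Integrable
        (fun ω => tensorMatrix _ p A f g *
          tensorMatrix _ p (fun _ => V ω * (V ω).conjTranspose) g (f ∘ finRotate p)) P :=
      fun f g => (hV.integrable_comp
        (continuous_tensorMatrix_mul_conjTranspose g (f ∘ finRotate p))).const_mul _
    simp only [h1]
    rw [MeasureTheory.integral_finsetSum _ fun f _ =>
      MeasureTheory.integrable_finsetSum _ fun g _ => hint f g]
    refine Finset.sum_congr rfl fun f _ => ?_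
    rw [MeasureTheory.integral_finsetSum _ fun g _ => hint f g]
    refine Finset.sum_congr rfl fun g _ => ?_
    rw [MeasureTheory.integral_const_mul]
    rfl
  rw [h2, weingarten_expansion hT]
  refine Finset.sum_congr rfl fun α _ => Finset.sum_congr rfl fun β _ => ?_
  -- `(fullCycle p)⁻¹` is `finRotate p` by definition.
  have h3 : ∑ g, T g (g ∘ β) = (d : ℂ) ^ cycleCount (β * (fullCycle p)⁻¹) :=
    hV.sum_momentMatrix_comp (β * finRotate p)
  rw [h3, Fintype.card_prod, Fintype.card_fin, Fintype.card_fin]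
  rfl

end IsHaarIsometry

/-! ### Permutations of at most two points -/

theorem cycleCount_one_two : cycleCount (1 : Equiv.Perm (Fin 2)) = 2 :=
  Nat.pow_right_injective le_rfl ((card_invariant_eq 2 2 _).symm.trans (by decide))

theorem cycleCount_swap_two : cycleCount (Equiv.swap 0 1 : Equiv.Perm (Fin 2)) = 1 :=
  Nat.pow_right_injective le_rfl ((card_invariant_eq 2 2 _).symm.trans (by decide))

theorem cycleCount_one_one : cycleCount (1 : Equiv.Perm (Fin 1)) = 1 :=
  Nat.pow_right_injective le_rfl ((card_invariant_eq 1 2 _).symm.trans (by decide))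

theorem sum_perm_two {M : Type*} [AddCommMonoid M] (F : Equiv.Perm (Fin 2) → M) :
    ∑ α, F α = F 1 + F (Equiv.swap 0 1) := by
  have h : (Finset.univ : Finset (Equiv.Perm (Fin 2))) = {1, Equiv.swap 0 1} := by decide
  rw [h, Finset.sum_pair (by decide)]

theorem inv_fullCycle_two : (fullCycle 2)⁻¹ = Equiv.swap 0 1 := by
  decide

theorem weingarten_one {N : ℕ} (hN : 1 ≤ N) :
    weingarten N (1 : Equiv.Perm (Fin 1)) = 1 / N := by
  have h := weingarten_convolution hN (1 : Equiv.Perm (Fin 1)) 1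
  have hN' : (N : ℝ) ≠ 0 := by positivity
  rw [Fintype.sum_unique, if_pos rfl] at h
  have h1 : (default : Equiv.Perm (Fin 1)) = 1 := rfl
  rw [h1, inv_one, mul_one, cycleCount_one_one, pow_one] at h
  field_simp
  exact h

theorem weingarten_two {N : ℕ} (hN : 2 ≤ N) :
    weingarten N (1 : Equiv.Perm (Fin 2)) = 1 / ((N : ℝ) ^ 2 - 1) ∧
      weingarten N (Equiv.swap 0 1 : Equiv.Perm (Fin 2)) = -1 / (N * ((N : ℝ) ^ 2 - 1)) := by
  have h1 := weingarten_convolution hN (1 : Equiv.Perm (Fin 2)) 1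
  have h2 := weingarten_convolution hN (1 : Equiv.Perm (Fin 2)) (Equiv.swap 0 1)
  have hN' : (2 : ℝ) ≤ N := by exact_mod_cast hN
  have hN2 : (N : ℝ) ^ 2 - 1 ≠ 0 := by nlinarith
  have hN0 : (N : ℝ) ≠ 0 := by positivity
  rw [sum_perm_two, if_pos rfl] at h1
  rw [sum_perm_two, if_neg (by decide)] at h2
  simp only [inv_one, one_mul, mul_one, Equiv.swap_inv, Equiv.swap_mul_self, cycleCount_one_two,
    cycleCount_swap_two, pow_one] at h1 h2
  set a := weingarten N (1 : Equiv.Perm (Fin 2))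
  set b := weingarten N (Equiv.swap 0 1 : Equiv.Perm (Fin 2))
  have h3 : a = -(b * N) := by
    apply mul_right_cancel₀ hN0
    linear_combination h2
  rw [h3] at h1 ⊢
  have h4 : b * (N * ((N : ℝ) ^ 2 - 1)) = -1 := by linear_combination -h1
  constructor
  · rw [eq_div_iff hN2]
    linear_combination -h4
  · rw [eq_div_iff (mul_ne_zero hN0 hN2), h4]

/-! ### The effects of the Haar-random POVM -/

/-- The isometry `v ↦ e_i ⊗ v` from `ℂ^n` to `ℂ^k ⊗ ℂ^n`. -/
noncomputable def blockIsometry {k : ℕ} (e : OrthonormalBasis (Fin k) ℂ (EuclideanSpace ℂ (Fin k)))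
    (n : ℕ) (i : Fin k) : Matrix (Fin k × Fin n) (Fin n) ℂ :=
  Matrix.of fun a c => if a.2 = c then (e i).ofLp a.1 else 0

theorem blockIsometry_conjTranspose_mul {k : ℕ}
    (e : OrthonormalBasis (Fin k) ℂ (EuclideanSpace ℂ (Fin k))) (n : ℕ) (i j : Fin k) :
    (blockIsometry e n i).conjTranspose * blockIsometry e n j = if i = j then 1 else 0 := by
  have h := orthonormal_iff_ite.mp e.orthonormal i j
  rw [PiLp.inner_apply] at h
  ext a b
  simp only [blockIsometry, Matrix.mul_apply, Matrix.conjTranspose_apply, Matrix.of_apply,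
    Fintype.sum_prod_type]
  have h2 : ∀ x : Fin k, ∑ y : Fin n, star (if y = a then (e i).ofLp x else 0) *
      (if y = b then (e j).ofLp x else 0) =
        if a = b then inner ℂ ((e i).ofLp x) ((e j).ofLp x) else 0 := by
    intro x
    rw [Finset.sum_eq_single a (fun y _ hy => by simp [hy]) (by simp)]
    by_cases hab : a = b
    · simp [hab, mul_comm]
    · simp [hab]
  simp only [h2]
  by_cases hab : a = b
  · by_cases hij : i = j <;> simp only [hab, hij, if_true, if_false] at h ⊢
    · rw [h, Matrix.one_apply_eq]
    · rw [h, Matrix.zero_apply]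
  · by_cases hij : i = j <;> simp [hab, hij]

theorem povmEffect_eq {d k n : ℕ} (e : OrthonormalBasis (Fin k) ℂ (EuclideanSpace ℂ (Fin k)))
    (V : Matrix (Fin k × Fin n) (Fin d) ℂ) (i : Fin k) :
    povmEffect e V i =
      V.conjTranspose * (blockIsometry e n i * (blockIsometry e n i).conjTranspose * V) := by
  rw [povmEffect, stinespringMap, Matrix.mul_assoc]
  congr 2
  ext a b
  simp only [blockIsometry, Matrix.kroneckerMap_apply, Matrix.vecMulVec_apply, Matrix.one_apply,
    Matrix.mul_apply, Matrix.conjTranspose_apply, Matrix.of_apply, Pi.star_apply]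
  rw [Finset.sum_eq_single a.2 (fun y _ hy => by simp [hy.symm]) (by simp)]
  by_cases hab : a.2 = b.2
  · simp [hab]
  · simp [hab, Ne.symm hab]

theorem trace_mul_pow_comm {ι κ : Type*} [Fintype ι] [DecidableEq ι] [Fintype κ] [DecidableEq κ]
    (A : Matrix κ ι ℂ) (B : Matrix ι κ ℂ) {p : ℕ} (hp : 1 ≤ p) :
    ((A * B) ^ p).trace = ((B * A) ^ p).trace := by
  have h : ∀ q : ℕ, (A * B) ^ q * A = A * (B * A) ^ q := by
    intro q
    induction q with
    | zero => simp
    | succ q ih => 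
      rw [pow_succ, Matrix.mul_assoc, Matrix.mul_assoc A B A, ← Matrix.mul_assoc, ih,
        Matrix.mul_assoc, ← pow_succ]
  obtain ⟨q, rfl⟩ : ∃ q, p = q + 1 := ⟨p - 1, by omega⟩
  rw [pow_succ, ← Matrix.mul_assoc, h, Matrix.trace_mul_comm, ← Matrix.mul_assoc, ← pow_succ']

theorem trace_povmEffect_pow {d k n : ℕ}
    (e : OrthonormalBasis (Fin k) ℂ (EuclideanSpace ℂ (Fin k)))
    (V : Matrix (Fin k × Fin n) (Fin d) ℂ) (i : Fin k) {p : ℕ} (hp : 1 ≤ p) :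
    (povmEffect e V i ^ p).trace = (List.ofFn fun _ : Fin p =>
      blockIsometry e n i * (blockIsometry e n i).conjTranspose *
        (V * V.conjTranspose)).prod.trace := by
  rw [povmEffect_eq, trace_mul_pow_comm _ _ hp, List.ofFn_const, List.prod_replicate]
  simp only [Matrix.mul_assoc]

theorem trace_povmEffect_mul {d k n : ℕ}
    (e : OrthonormalBasis (Fin k) ℂ (EuclideanSpace ℂ (Fin k)))
    (V : Matrix (Fin k × Fin n) (Fin d) ℂ) (i j : Fin k) :
    (povmEffect e V i * povmEffect e V j).trace = (List.ofFn fun l : Fin 2 =>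
      blockIsometry e n (![i, j] l) * (blockIsometry e n (![i, j] l)).conjTranspose *
        (V * V.conjTranspose)).prod.trace := by
  rw [povmEffect_eq, povmEffect_eq, Matrix.mul_assoc, Matrix.trace_mul_comm]
  simp [List.ofFn_succ, Matrix.mul_assoc]

namespace IsHaarIsometry

variable {Ω : Type*} [MeasurableSpace Ω] {P : MeasureTheory.Measure Ω}
  [MeasureTheory.IsProbabilityMeasure P] {d k n : ℕ}
  {V : Ω → Matrix (Fin k × Fin n) (Fin d) ℂ}

theorem integral_trace_povmEffect_pow (hV : IsHaarIsometry P V)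
    (e : OrthonormalBasis (Fin k) ℂ (EuclideanSpace ℂ (Fin k))) (i : Fin k) {p : ℕ}
    (hp : 1 ≤ p) :
    ∫ ω, (povmEffect e (V ω) i ^ p).trace ∂P =
      ((∑ α : Equiv.Perm (Fin p), ∑ β : Equiv.Perm (Fin p),
        (n : ℝ) ^ cycleCount α * (d : ℝ) ^ cycleCount (β * (fullCycle p)⁻¹) *
          weingarten (k * n) (α⁻¹ * β) : ℝ) : ℂ) := by
  simp only [trace_povmEffect_pow e _ i hp]
  rw [hV.integral_trace_list hp]
  push_cast
  refine Finset.sum_congr rfl fun α _ => Finset.sum_congr rfl fun β _ => ?_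
  congr 2
  have hW : (blockIsometry e n i).conjTranspose * blockIsometry e n i = 1 := by
    rw [blockIsometry_conjTranspose_mul, if_pos rfl]
  have h := sum_prod_isometry_projection hW α⁻¹
  rw [Fintype.card_fin, cycleCount_inv] at h
  rw [← h]
  refine Finset.sum_congr rfl fun f _ => ?_
  rw [← Equiv.prod_comp α (fun l =>
    (blockIsometry e n i * (blockIsometry e n i).conjTranspose) (f l) (f (α⁻¹ l)))]
  simp

theorem integral_trace_povmEffect_mul (hV : IsHaarIsometry P V)
    (e : OrthonormalBasis (Fin k) ℂ (EuclideanSpace ℂ (Fin k))) {i j : Fin k} (hij : i ≠ j) :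
    ∫ ω, (povmEffect e (V ω) i * povmEffect e (V ω) j).trace ∂P =
      ((n ^ 2 * d * weingarten (k * n) (1 : Equiv.Perm (Fin 2)) +
        n ^ 2 * d ^ 2 *
          weingarten (k * n) (Equiv.swap 0 1 : Equiv.Perm (Fin 2)) : ℝ) : ℂ) := by
  simp only [trace_povmEffect_mul]
  rw [hV.integral_trace_list one_le_two]
  have htr : ∀ l : Fin k,
      (blockIsometry e n l * (blockIsometry e n l).conjTranspose).trace = n := by
    intro l
    rw [Matrix.trace_mul_comm, blockIsometry_conjTranspose_mul, if_pos rfl, Matrix.trace_one,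
      Fintype.card_fin]
  have hsum : ∀ F : (Fin 2 → Fin k × Fin n) → ℂ,
      ∑ g, F g = ∑ a, ∑ b, F ![a, b] := by
    intro F
    rw [← (finTwoArrowEquiv (Fin k × Fin n)).symm.sum_comp, Fintype.sum_prod_type]
    rfl
  let b : Equiv.Perm (Fin 2) → ℂ := fun α => ∑ g : Fin 2 → Fin k × Fin n, ∏ l,
    (blockIsometry e n (![i, j] l) * (blockIsometry e n (![i, j] l)).conjTranspose)
      (g (α l)) (g l)
  have hid : b 1 = (n : ℂ) ^ 2 := by
    simp only [b]
    rw [hsum, pow_two]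
    refine Eq.trans ?_ (congrArg₂ (· * ·) (htr i) (htr j))
    simp only [Matrix.trace, Finset.sum_mul_sum]
    simp [Fin.prod_univ_two]
  have hsw : b (Equiv.swap 0 1) = 0 := by
    have h0 : blockIsometry e n i * (blockIsometry e n i).conjTranspose *
        (blockIsometry e n j * (blockIsometry e n j).conjTranspose) = 0 := by
      rw [Matrix.mul_assoc, ← Matrix.mul_assoc _ (blockIsometry e n j),
        blockIsometry_conjTranspose_mul, if_neg hij, Matrix.zero_mul, Matrix.mul_zero]
    have h1 := congrArg Matrix.trace h0
    rw [Matrix.trace_zero, Matrix.trace] at h1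
    simp only [Matrix.diag_apply, Matrix.mul_apply (M := _ * _)] at h1
    simp only [b]
    rw [hsum, Finset.sum_comm, ← h1]
    simp [Fin.prod_univ_two]
  change ∑ α, ∑ β, b α * _ * _ = _
  rw [sum_perm_two, sum_perm_two, sum_perm_two, hid, hsw, inv_fullCycle_two]
  simp only [inv_one, one_mul, Equiv.swap_mul_self, cycleCount_one_two, cycleCount_swap_two]
  push_cast
  ring

end IsHaarIsometry

theorem mainTheorem4 {Ω : Type*} [MeasurableSpace Ω] (P : MeasureTheory.Measure Ω)
    [MeasureTheory.IsProbabilityMeasure P] (d k n : ℕ) (hdkn : d ≤ k * n)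
    (V : Ω → Matrix (Fin k × Fin n) (Fin d) ℂ) (hV : IsHaarIsometry P V)
    (e : OrthonormalBasis (Fin k) ℂ (EuclideanSpace ℂ (Fin k)))
    (M : Ω → Fin k → Matrix (Fin d) (Fin d) ℂ) (hM : ∀ ω i, M ω i = povmEffect e (V ω) i) :
    (∀ (i : Fin k) (p : ℕ), 1 ≤ p →
      MeasureTheory.Integrable (fun ω => (M ω i ^ p).trace) P ∧
      ∫ ω, (M ω i ^ p).trace ∂P =
        ((∑ α : Equiv.Perm (Fin p), ∑ β : Equiv.Perm (Fin p),
          (n : ℝ) ^ cycleCount α * (d : ℝ) ^ cycleCount (β * (fullCycle p)⁻¹) *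
            weingarten (k * n) (α⁻¹ * β) : ℝ) : ℂ)) ∧
    (∀ i : Fin k,
      ∫ ω, (M ω i).trace ∂P =
        ((d * n * weingarten (k * n) (1 : Equiv.Perm (Fin 1)) : ℝ) : ℂ) ∧
      ∫ ω, (M ω i).trace ∂P = ((d / k : ℝ) : ℂ)) ∧
    (∀ i : Fin k,
      ∫ ω, (M ω i ^ 2).trace ∂P =
        (((n ^ 2 * d + n * d ^ 2) * weingarten (k * n) (1 : Equiv.Perm (Fin 2)) +
          (n ^ 2 * d ^ 2 + n * d) *
            weingarten (k * n) (Equiv.swap 0 1 : Equiv.Perm (Fin 2)) : ℝ) : ℂ) ∧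
      (k * n ≠ 1 → ∫ ω, (M ω i ^ 2).trace ∂P =
        ((d * (k * n ^ 2 + d * n * (k - 1) - 1) / (k * ((k * n) ^ 2 - 1)) : ℝ) : ℂ))) ∧
    (∀ i j : Fin k, i ≠ j →
      MeasureTheory.Integrable (fun ω => (M ω i * M ω j).trace) P ∧
      ∫ ω, (M ω i * M ω j).trace ∂P =
        ((n ^ 2 * d * weingarten (k * n) (1 : Equiv.Perm (Fin 2)) +
          n ^ 2 * d ^ 2 *
            weingarten (k * n) (Equiv.swap 0 1 : Equiv.Perm (Fin 2)) : ℝ) : ℂ) ∧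
      ∫ ω, (M ω i * M ω j).trace ∂P =
        ((n * d * (k * n - d) / (k * ((k * n) ^ 2 - 1)) : ℝ) : ℂ)) := by

  have hpow : ∀ (i : Fin k) (p : ℕ), 1 ≤ p → ∫ ω, (M ω i ^ p).trace ∂P =
      ((∑ α : Equiv.Perm (Fin p), ∑ β : Equiv.Perm (Fin p),
        (n : ℝ) ^ cycleCount α * (d : ℝ) ^ cycleCount (β * (fullCycle p)⁻¹) *
          weingarten (k * n) (α⁻¹ * β) : ℝ) : ℂ) := by
    intro i p hp
    simp only [hM]
    exact hV.integral_trace_povmEffect_pow e i hp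
  have hone : ∀ i : Fin k, ∫ ω, (M ω i).trace ∂P =
      ((d * n * weingarten (k * n) (1 : Equiv.Perm (Fin 1)) : ℝ) : ℂ) := by
    intro i
    have h := hpow i 1 le_rfl
    simp only [pow_one] at h
    rw [h, Fintype.sum_unique, Fintype.sum_unique]
    have h1 : (default : Equiv.Perm (Fin 1)) = 1 := rfl
    have h2 : (fullCycle 1)⁻¹ = 1 := Subsingleton.elim _ _
    rw [h1, h2, inv_one, one_mul, cycleCount_one_one, pow_one, pow_one, mul_comm (n : ℝ)]
  have htwo : ∀ i : Fin k, ∫ ω, (M ω i ^ 2).trace ∂P =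
      (((n ^ 2 * d + n * d ^ 2) * weingarten (k * n) (1 : Equiv.Perm (Fin 2)) +
        (n ^ 2 * d ^ 2 + n * d) *
          weingarten (k * n) (Equiv.swap 0 1 : Equiv.Perm (Fin 2)) : ℝ) : ℂ) := by
    intro i
    rw [hpow i 2 one_le_two, sum_perm_two, sum_perm_two, sum_perm_two, inv_fullCycle_two]
    simp only [inv_one, one_mul, mul_one, Equiv.swap_inv, Equiv.swap_mul_self,
      cycleCount_one_two, cycleCount_swap_two, pow_one]
    congr 1
    ring
  have hk : ∀ _ : Fin k, (k : ℝ) ≠ 0 := fun i => by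
    exact_mod_cast (i.pos).ne'
  -- The boundary case `n = 0` forces `d = 0`, where all expectations vanish.
  have hn : n = 0 → d = 0 := by
    rintro rfl
    simpa using hdkn
  have hden : 2 ≤ k * n → ((k : ℝ) * n) ^ 2 - 1 ≠ 0 := by
    intro h
    have : (2 : ℝ) ≤ k * n := by exact_mod_cast h
    nlinarith
  refine ⟨fun i p hp => ⟨?_, hpow i p hp⟩, fun i => ⟨hone i, ?_⟩, fun i => ⟨htwo i, ?_⟩,
    fun i j hij => ⟨?_, ?_, ?_⟩⟩
  · simp only [hM, trace_povmEffect_pow e _ i hp]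
    exact hV.integrable_trace_list hp _
  · rw [hone]
    rcases Nat.eq_zero_or_pos n with h | h
    · simp [hn h]
    · have hk' := hk i
      have hn' : (n : ℝ) ≠ 0 := by positivity
      rw [weingarten_one (Nat.mul_pos i.pos h)]
      congr 1
      push_cast
      field_simp
  · intro hkn
    rw [htwo]
    rcases Nat.eq_zero_or_pos n with h | h
    · simp [hn h, h]
    · have h2 : 2 ≤ k * n := by have := Nat.mul_pos i.pos h; omega
      have hk' := hk i
      have hn' : (n : ℝ) ≠ 0 := by positivity
      have hd' := hden h2
      rw [(weingarten_two h2).1, (weingarten_two h2).2]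
      congr 1
      push_cast
      field_simp
      ring
  · simp only [hM, trace_povmEffect_mul]
    exact hV.integrable_trace_list one_le_two _
  · simp only [hM]
    exact hV.integral_trace_povmEffect_mul e hij
  · simp only [hM]
    rw [hV.integral_trace_povmEffect_mul e hij]
    rcases Nat.eq_zero_or_pos n with h | h
    · simp [h]
    · have h2 : 2 ≤ k * n := by
        have h3 : 2 ≤ k := by
          have := i.2; have := j.2; have := Fin.val_ne_of_ne hij; omega
        nlinarith
      have hk' := hk i
      have hn' : (n : ℝ) ≠ 0 := by positivity
      have hd' := hden h2
      rw [(weingarten_two h2).1, (weingarten_two h2).2]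
      congr 1
      push_cast
      field_simp
      ring
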